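/- Let $\rho_{AB}$ be a two-qubit state, i.e. a positive semidefinite operator of trace one on $\mathbb{C}^2\otimes\mathbb{C}^2$, with product basis $|m\,n\rangle$, $m,n\in\{0,1\}$. Let $\rho_{AB}=\sum_{m,n\in\{0,1\}} p_{mn}|\psi_{mn}\rangle\langle\psi_{mn}|$ be an eigendecomposition with $(|\psi_{mn}\rangle)$ an orthonormal basis and eigenvalues in decreasing order, $p_{00}\ge p_{01}\ge p_{10}\ge p_{11}$. Let $D$ be the disentangling unitary, $D|\psi_{mn}\rangle=|m\,n\rangle$; for a permutation $s$ of $\{0,1\}^2$ let $U_s$ be the unitary with $U_s|m\,n\rangle=|s(m,n)\rangle$; and let $s_5$ be the permutation whose inverse is $s_5^{-1}(m,n)=(n,\ m+n \bmod 2)$. For a unitary $U\in U(4)$ put $\rho_A^U=\operatorname{Tr}_B(U\rho_{AB}U^\dagger)$ and $\rho_B^U=\operatorname{Tr}_A(U\rho_{AB}U^\dagger)$, and let $S(\sigma)=-\operatorname{Tr}(\sigma\log_2\sigma)$ be the von Neumann entropy. Then $U^*=U_{s_5}D$ is a local maximum of the function $U\mapsto S(\rho_A^U)-S(\rho_B^U)$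 on the unitary group $U(4)$. -/

import Mathlib

open Matrix
open scoped ComplexOrder

noncomputable section

namespace EntropyDifference

/-- The index set of the product basis `|m n⟩` of two `d`-level systems `A` and `B`. -/
abbrev Idx (d : ℕ) := Fin d × Fin d

/-- The unitary group `U(d²)` of the Hilbert space of the two systems. -/
abbrev U (d : ℕ) := Matrix.unitaryGroup (Idx d) ℂ

/-- A quantum state (density matrix): positive semidefinite with trace one. -/
def IsState {ι : Type*} [Fintype ι] (ρ : Matrix ι ι ℂ) : Prop :=
  ρ.PosSemidef ∧ ρ.trace = 1

/-- The von Neumann entropy `S(σ) = -Tr (σ log₂ σ)`, where `log₂ σ` is given by the functional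
calculus of Hermitian matrices. -/
def entropy {ι : Type*} [Fintype ι] [DecidableEq ι] (σ : Matrix ι ι ℂ) : ℝ :=
  -((σ * cfc (Real.logb 2) σ).trace).re

/-- The partial trace over the second system `B`. -/
def traceB {d : ℕ} (ρ : Matrix (Idx d) (Idx d) ℂ) : Matrix (Fin d) (Fin d) ℂ :=
  Matrix.of fun m m' => ∑ n, ρ (m, n) (m', n)

/-- The partial trace over the first system `A`. -/
def traceA {d : ℕ} (ρ : Matrix (Idx d) (Idx d) ℂ) : Matrix (Fin d) (Fin d) ℂ :=
  Matrix.of fun n n' => ∑ m, ρ (m, n) (m, n')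

/-- The reduced state `ρ_A^V = Tr_B (V ρ V†)`. -/
def reducedA {d : ℕ} (ρ : Matrix (Idx d) (Idx d) ℂ) (V : U d) : Matrix (Fin d) (Fin d) ℂ :=
  traceB (V.1 * ρ * V.1ᴴ)

/-- The reduced state `ρ_B^V = Tr_A (V ρ V†)`. -/
def reducedB {d : ℕ} (ρ : Matrix (Idx d) (Idx d) ℂ) (V : U d) : Matrix (Fin d) (Fin d) ℂ :=
  traceA (V.1 * ρ * V.1ᴴ)

/-- The entropy difference `ΔS(V) = S(ρ_A^V) - S(ρ_B^V)`. -/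
def entropyDiff {d : ℕ} (ρ : Matrix (Idx d) (Idx d) ℂ) (V : U d) : ℝ :=
  entropy (reducedA ρ V) - entropy (reducedB ρ V)

/-- `ρ = ∑ p_mn |ψ_mn⟩⟨ψ_mn|` for the orthonormal basis `ψ`, with the eigenvalues `p_mn` in
decreasing order with respect to the lexicographic order of the pairs `(m, n)`. -/
structure IsEigendecomposition {d : ℕ} (ρ : Matrix (Idx d) (Idx d) ℂ) (p : Idx d → ℝ)
    (ψ : OrthonormalBasis (Idx d) ℂ (EuclideanSpace ℂ (Idx d))) : Prop where
  eq_sum : ρ = ∑ k, (p k : ℂ) • Matrix.vecMulVec (ψ k).ofLp (star (ψ k).ofLp)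
  decreasing : ∀ k l : Idx d,
    k.1.val * d + k.2.val ≤ l.1.val * d + l.2.val → p l ≤ p k

/-- The disentangling unitary `D = ∑ |m n⟩⟨ψ_mn|`. -/
def disentangle {d : ℕ} (ψ : OrthonormalBasis (Idx d) ℂ (EuclideanSpace ℂ (Idx d))) : U d :=
  ⟨Matrix.of fun k j => star (ψ k j), by
    rw [Matrix.mem_unitaryGroup_iff]
    ext k l
    have h := orthonormal_iff_ite.mp ψ.orthonormal k l
    simp only [PiLp.inner_apply, RCLike.inner_apply] at h
    simp only [Matrix.mul_apply, Matrix.star_apply, Matrix.of_apply, star_star,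
      Matrix.one_apply]
    rw [← h]
    exact Finset.sum_congr rfl fun j _ => mul_comm _ _⟩

/-- The unitary `U_s |m n⟩ = |s (m n)⟩` of a permutation `s` of the product basis. -/
def permUnitary {d : ℕ} (s : Equiv.Perm (Idx d)) : U d :=
  ⟨Matrix.of fun k j => if k = s j then 1 else 0, by
    rw [Matrix.mem_unitaryGroup_iff']
    ext k l
    simp [Matrix.mul_apply, Matrix.one_apply, apply_ite, eq_comm]⟩

/-- The defining property `D |ψ_mn⟩ = |m n⟩`. -/
theorem disentangle_mulVec {d : ℕ}
    (ψ : OrthonormalBasis (Idx d) ℂ (EuclideanSpace ℂ (Idx d))) (k : Idx d) :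
    (disentangle ψ).1 *ᵥ (ψ k).ofLp = Pi.single k 1 := by
  ext l
  have h := orthonormal_iff_ite.mp ψ.orthonormal l k
  simp only [PiLp.inner_apply, RCLike.inner_apply] at h
  simp only [disentangle, Matrix.mulVec, dotProduct, Matrix.of_apply, Pi.single_apply]
  rw [← h]
  exact Finset.sum_congr rfl fun j _ => mul_comm _ _

/-- The defining property `U_s |m n⟩ = |s (m n)⟩`. -/
theorem permUnitary_mulVec {d : ℕ} (s : Equiv.Perm (Idx d)) (k : Idx d) :
    (permUnitary s).1 *ᵥ Pi.single k 1 = Pi.single (s k) 1 := by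
  ext l
  simp [permUnitary, Pi.single_apply]

/-- The permutation `s₅` with `s₅⁻¹ (m, n) = (n, m + n mod 2)`; addition in `Fin 2` is modulo 2. -/
def s5 : Equiv.Perm (Idx 2) :=
  Equiv.symm
    { toFun := fun k => (k.2, k.1 + k.2)
      invFun := fun k => (k.1 + k.2, k.1)
      left_inv := by decide
      right_inv := by decide }

end EntropyDifference

end

open scoped Kronecker

namespace EntropyDifference

/-! The point is in fact a global maximum. If `s, u ≥ 1/2` are the larger eigenvalues of the two
reduced states, the entropy difference is `(h(s) - h(u)) / log 2` with `h` the binary entropy, so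
only the pairs `(s, u)` reachable by unitaries matter. `reduced_spectra_bounds` restricts them: `u ≤
p₀₀ + p₀₁`, while `s - u` is at least both `p₁₁ - p₀₁` and `p₁₀ - p₀₀`. The lower bounds come from
measuring in a product basis `G ⊗ W`: `W` diagonalises the state of `B`, and `G` is free, so it can
be chosen to kill one overlap with an eigenvector. At the optimum `u₀ = p₀₀ + p₀₁`, and `s₀` is the
larger of `p₀₀ + p₁₁` and `p₀₁ + p₁₀`; each choice makes one of the lower bounds tight. As `h` is
concave and decreasing on `[1/2, 1]`, `binEntropy_sub_le` shows that no admissible pair does better.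
-/

/-! ### Diagonal form of the state and weights of unitary rows and columns -/

theorem IsEigendecomposition.eq_conj_diagonal {d : ℕ} {ρ : Matrix (Idx d) (Idx d) ℂ}
    {p : Idx d → ℝ} {ψ : OrthonormalBasis (Idx d) ℂ (EuclideanSpace ℂ (Idx d))}
    (h : IsEigendecomposition ρ p ψ) :
    ρ = (disentangle ψ).1ᴴ * diagonal (fun k => (p k : ℂ)) * (disentangle ψ).1 := by
  rw [h.eq_sum]
  ext i j
  rw [Matrix.mul_apply]
  simp only [Matrix.sum_apply, Matrix.smul_apply, vecMulVec_apply,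
    Matrix.mul_diagonal, conjTranspose_apply, disentangle, Matrix.of_apply, star_star,
    Pi.star_apply, smul_eq_mul]
  exact Finset.sum_congr rfl fun k _ => by ring

theorem conj_diagonal_apply_self {m n : Type*} [Fintype n] [DecidableEq n]
    (R : Matrix m n ℂ) (p : n → ℝ) (k : m) :
    (R * diagonal (fun j => (p j : ℂ)) * Rᴴ) k k =
      ((∑ j, p j * Complex.normSq (R k j) : ℝ) : ℂ) := by
  rw [Matrix.mul_apply]
  simp only [Matrix.mul_diagonal, conjTranspose_apply]
  push_cast
  refine Finset.sum_congr rfl fun j _ => ?_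
  rw [Complex.normSq_eq_conj_mul_self, Complex.star_def]
  ring

theorem sum_normSq_row {n : Type*} [Fintype n] [DecidableEq n] {R : Matrix n n ℂ}
    (hR : R ∈ unitaryGroup n ℂ) (k : n) : ∑ j, Complex.normSq (R k j) = 1 := by
  have h := congrFun (congrFun (mem_unitaryGroup_iff.mp hR) k) k
  have h' := conj_diagonal_apply_self R (fun _ => 1) k
  simp only [Complex.ofReal_one, diagonal_one, mul_one, one_mul] at h'
  rw [← star_eq_conjTranspose, h, one_apply_eq] at h'
  exact_mod_cast h'.symm

theorem sum_normSq_col {n : Type*} [Fintype n] [DecidableEq n] {R : Matrix n n ℂ}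
    (hR : R ∈ unitaryGroup n ℂ) (j : n) : ∑ k, Complex.normSq (R k j) = 1 := by
  have h := sum_normSq_row (Unitary.star_mem hR) j
  simpa [star_eq_conjTranspose] using h

/-! ### Partial traces under local unitaries -/

/-- Tracing out `B` contracts the two copies of `W` into an entry of `W Wᴴ = 1`; the four entry
identities are weighted by the remaining factors. -/
theorem traceB_conj_kronecker {F W : Matrix (Fin 2) (Fin 2) ℂ}
    (hW : W ∈ unitaryGroup (Fin 2) ℂ) (ρ : Matrix (Idx 2) (Idx 2) ℂ) :
    traceB ((F ⊗ₖ W)ᴴ * ρ * (F ⊗ₖ W)) = Fᴴ * traceB ρ * F := by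
  have h := mem_unitaryGroup_iff.mp hW
  have h00 := congrFun (congrFun h 0) 0
  have h01 := congrFun (congrFun h 0) 1
  have h10 := congrFun (congrFun h 1) 0
  have h11 := congrFun (congrFun h 1) 1
  simp only [Matrix.mul_apply, star_apply, Fin.sum_univ_two, one_apply_eq,
    one_apply_ne (show (0 : Fin 2) ≠ 1 by decide),
    one_apply_ne (show (1 : Fin 2) ≠ 0 by decide)] at h00 h01 h10 h11
  ext m m'
  simp only [traceB, Matrix.of_apply, Matrix.mul_apply, conjTranspose_apply, kroneckerMap_apply,
    Fintype.sum_prod_type, Fin.sum_univ_two, star_mul']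
  linear_combination
    (star (F 0 m) * F 0 m' * ρ (0, 0) (0, 0) +
      star (F 0 m) * F 1 m' * ρ (0, 0) (1, 0) +
      star (F 1 m) * F 0 m' * ρ (1, 0) (0, 0) +
      star (F 1 m) * F 1 m' * ρ (1, 0) (1, 0)) * h00 +
    (star (F 0 m) * F 0 m' * ρ (0, 1) (0, 0) +
      star (F 0 m) * F 1 m' * ρ (0, 1) (1, 0) +
      star (F 1 m) * F 0 m' * ρ (1, 1) (0, 0) +
      star (F 1 m) * F 1 m' * ρ (1, 1) (1, 0)) * h01 +
    (star (F 0 m) * F 0 m' * ρ (0, 0) (0, 1) +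
      star (F 0 m) * F 1 m' * ρ (0, 0) (1, 1) +
      star (F 1 m) * F 0 m' * ρ (1, 0) (0, 1) +
      star (F 1 m) * F 1 m' * ρ (1, 0) (1, 1)) * h10 +
    (star (F 0 m) * F 0 m' * ρ (0, 1) (0, 1) +
      star (F 0 m) * F 1 m' * ρ (0, 1) (1, 1) +
      star (F 1 m) * F 0 m' * ρ (1, 1) (0, 1) +
      star (F 1 m) * F 1 m' * ρ (1, 1) (1, 1)) * h11

theorem traceA_conj_kronecker {F W : Matrix (Fin 2) (Fin 2) ℂ}
    (hF : F ∈ unitaryGroup (Fin 2) ℂ) (ρ : Matrix (Idx 2) (Idx 2) ℂ) :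
    traceA ((F ⊗ₖ W)ᴴ * ρ * (F ⊗ₖ W)) = Wᴴ * traceA ρ * W := by
  have h := mem_unitaryGroup_iff.mp hF
  have h00 := congrFun (congrFun h 0) 0
  have h01 := congrFun (congrFun h 0) 1
  have h10 := congrFun (congrFun h 1) 0
  have h11 := congrFun (congrFun h 1) 1
  simp only [Matrix.mul_apply, star_apply, Fin.sum_univ_two, one_apply_eq,
    one_apply_ne (show (0 : Fin 2) ≠ 1 by decide),
    one_apply_ne (show (1 : Fin 2) ≠ 0 by decide)] at h00 h01 h10 h11
  ext m m'
  simp only [traceA, Matrix.of_apply, Matrix.mul_apply, conjTranspose_apply, kroneckerMap_apply,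
    Fintype.sum_prod_type, Fin.sum_univ_two, star_mul']
  linear_combination
    (star (W 0 m) * W 0 m' * ρ (0, 0) (0, 0) +
      star (W 0 m) * W 1 m' * ρ (0, 0) (0, 1) +
      star (W 1 m) * W 0 m' * ρ (0, 1) (0, 0) +
      star (W 1 m) * W 1 m' * ρ (0, 1) (0, 1)) * h00 +
    (star (W 0 m) * W 0 m' * ρ (1, 0) (0, 0) +
      star (W 0 m) * W 1 m' * ρ (1, 0) (0, 1) +
      star (W 1 m) * W 0 m' * ρ (1, 1) (0, 0) +
      star (W 1 m) * W 1 m' * ρ (1, 1) (0, 1)) * h01 +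
    (star (W 0 m) * W 0 m' * ρ (0, 0) (1, 0) +
      star (W 0 m) * W 1 m' * ρ (0, 0) (1, 1) +
      star (W 1 m) * W 0 m' * ρ (0, 1) (1, 0) +
      star (W 1 m) * W 1 m' * ρ (0, 1) (1, 1)) * h10 +
    (star (W 0 m) * W 0 m' * ρ (1, 0) (1, 0) +
      star (W 0 m) * W 1 m' * ρ (1, 0) (1, 1) +
      star (W 1 m) * W 0 m' * ρ (1, 1) (1, 0) +
      star (W 1 m) * W 1 m' * ρ (1, 1) (1, 1)) * h11

/-! ### Qubit unitaries, diagonalisation and entropy -/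

/-- A unitary whose first column is orthogonal to a given vector. -/
theorem exists_unitary_conjTranspose_mulVec_zero (c : Fin 2 → ℂ) :
    ∃ G ∈ unitaryGroup (Fin 2) ℂ, (Gᴴ *ᵥ c) 0 = 0 := by
  by_cases hc : c = 0
  · exact ⟨1, one_mem _, by simp [hc]⟩
  set N : ℝ := Complex.normSq (c 0) + Complex.normSq (c 1) with hN
  have hpos : 0 < N := by
    rcases Complex.normSq_nonneg (c 0) |>.lt_or_eq with h | h
    · exact add_pos_of_pos_of_nonneg h (Complex.normSq_nonneg _)
    rcases Complex.normSq_nonneg (c 1) |>.lt_or_eq with h' | h'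
    · exact add_pos_of_nonneg_of_pos (Complex.normSq_nonneg _) h'
    refine (hc ?_).elim
    ext i
    fin_cases i
    · exact Complex.normSq_eq_zero.mp h.symm
    · exact Complex.normSq_eq_zero.mp h'.symm
  have hs : ((√N : ℝ) : ℂ) * ((√N : ℝ) : ℂ) = c 0 * star (c 0) + c 1 * star (c 1) := by
    rw [← Complex.ofReal_mul, Real.mul_self_sqrt hpos.le, hN]
    simp [Complex.mul_conj]
  have hs0 : ((√N : ℝ) : ℂ) ≠ 0 := by
    exact_mod_cast (Real.sqrt_pos.mpr hpos).ne'
  refine ⟨((√N : ℝ) : ℂ)⁻¹ • !![-star (c 1), c 0; star (c 0), c 1], ?_, ?_⟩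
  · rw [mem_unitaryGroup_iff']
    ext i j
    fin_cases i <;> fin_cases j <;>
      simp [Matrix.mul_apply, Fin.sum_univ_two] at hs ⊢ <;> field_simp <;>
      first | linear_combination -hs | ring
  · simp [Matrix.mulVec, dotProduct, Fin.sum_univ_two]
    ring

/-- Diagonalisation of a Hermitian qubit matrix of trace one. -/
theorem exists_unitary_diagonal {M : Matrix (Fin 2) (Fin 2) ℂ} (hM : M.IsHermitian)
    (ht : M.trace = 1) :
    ∃ F ∈ unitaryGroup (Fin 2) ℂ, ∃ s : ℝ, 2⁻¹ ≤ s ∧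
      Fᴴ * M * F = diagonal ![(s : ℂ), ((1 - s : ℝ) : ℂ)] ∧
      entropy M = Real.binEntropy s / Real.log 2 := by
  have hsum : hM.eigenvalues 0 + hM.eigenvalues 1 = 1 := by
    have := hM.trace_eq_sum_eigenvalues
    rw [ht, Fin.sum_univ_two, ← RCLike.ofReal_add] at this
    exact Complex.ofReal_eq_one.mp this.symm
  have hent : entropy M = Real.binEntropy (hM.eigenvalues 0) / Real.log 2 := by
    have hmul : M * cfc (Real.logb 2) M = Unitary.conjStarAlgAut ℂ _ hM.eigenvectorUnitary
        (diagonal (fun i => ((hM.eigenvalues i * Real.logb 2 (hM.eigenvalues i) : ℝ) : ℂ))) := by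
      rw [hM.cfc_eq, IsHermitian.cfc]
      nth_rw 1 [hM.spectral_theorem]
      rw [← map_mul, diagonal_mul_diagonal]
      simp
    rw [entropy, hmul, Unitary.conjStarAlgAut_apply, Matrix.trace_mul_cycle]
    simp only [Unitary.coe_star_mul_self, one_mul, trace_diagonal, Fin.sum_univ_two]
    rw [← Complex.ofReal_add, Complex.ofReal_re,
      Real.binEntropy_eq_negMulLog_add_negMulLog_one_sub, ← hsum, add_sub_cancel_left]
    simp only [Real.negMulLog, Real.logb]
    ring
  have hdiag : (hM.eigenvectorUnitary : Matrix (Fin 2) (Fin 2) ℂ)ᴴ * M *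
      hM.eigenvectorUnitary = diagonal (fun i => (hM.eigenvalues i : ℂ)) := by
    have := hM.conjStarAlgAut_star_eigenvectorUnitary
    rwa [Unitary.conjStarAlgAut_star_apply] at this
  have h1 : hM.eigenvalues 1 = 1 - hM.eigenvalues 0 := by linarith
  by_cases h : 2⁻¹ ≤ hM.eigenvalues 0
  · refine ⟨_, hM.eigenvectorUnitary.2, _, h, ?_, hent⟩
    rw [hdiag, ← h1]
    congr 1
    ext i
    fin_cases i <;> rfl
  · refine ⟨(hM.eigenvectorUnitary : Matrix (Fin 2) (Fin 2) ℂ) * !![0, 1; 1, 0],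
      mul_mem hM.eigenvectorUnitary.2 ?_, 1 - hM.eigenvalues 0, by linarith, ?_, ?_⟩
    · rw [mem_unitaryGroup_iff]
      ext i j
      fin_cases i <;> fin_cases j <;> simp [Matrix.mul_apply]
    · rw [conjTranspose_mul, show ∀ a b c d e : Matrix (Fin 2) (Fin 2) ℂ,
        a * b * c * (d * e) = a * (b * c * d) * e from fun _ _ _ _ _ => by
          simp only [Matrix.mul_assoc], hdiag, sub_sub_cancel, ← h1]
      ext i j
      fin_cases i <;> fin_cases j <;> simp [Matrix.mul_apply, diagonal]
    · rw [hent, Real.binEntropy_one_sub]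

/-- Trace and determinant fix the spectrum up to exchanging `s` and `1 - s`, to which binary entropy
is blind. -/
theorem entropy_diagonal_qubit (d : ℝ) :
    entropy (diagonal ![(d : ℂ), ((1 - d : ℝ) : ℂ)]) = Real.binEntropy d / Real.log 2 := by
  have hM : (diagonal ![(d : ℂ), ((1 - d : ℝ) : ℂ)]).IsHermitian := by
    rw [isHermitian_diagonal_iff]
    intro i
    fin_cases i <;> simp [isSelfAdjoint_iff]
  obtain ⟨F, hF, s, -, hs, he⟩ := exists_unitary_diagonal hM (by simp [trace_diagonal])
  have hdet := congrArg det hs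
  rw [det_mul_right_comm, ← star_eq_conjTranspose, mem_unitaryGroup_iff'.mp hF, one_mul] at hdet
  simp only [det_diagonal, Fin.prod_univ_two, cons_val_zero, cons_val_one] at hdet
  have hd : (s - d) * (s - (1 - d)) = 0 := by
    have : d * (1 - d) = s * (1 - s) := by exact_mod_cast hdet
    linear_combination this
  rcases mul_eq_zero.mp hd with h | h
  · rw [he, sub_eq_zero.mp h]
  · rw [he, sub_eq_zero.mp h, Real.binEntropy_one_sub]

/-! ### The scalar inequality for binary entropy -/

/-- Translating `(s₀, u₀)` left by `t` keeps the gap and, by concavity, cannot increase `h(s₀) -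
h(u₀)`. Monotonicity then compares the translated pair with `(s, u)`. -/
theorem binEntropy_sub_le {s u s₀ u₀ : ℝ} (hs : 2⁻¹ ≤ s) (hs1 : s ≤ 1) (hu : 2⁻¹ ≤ u)
    (hs₀ : 2⁻¹ ≤ s₀) (hsu₀ : s₀ ≤ u₀) (hu₀ : u₀ ≤ 1) (huu₀ : u ≤ u₀)
    (h : s₀ - u₀ ≤ s - u) :
    Real.binEntropy s - Real.binEntropy u ≤ Real.binEntropy s₀ - Real.binEntropy u₀ := by
  -- Translate until `u₀` reaches `u` or `s₀` reaches `1/2`, whichever is first.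
  obtain ⟨t, ht0, ht1, ht2, ht3⟩ : ∃ t, 0 ≤ t ∧ t ≤ u₀ - u ∧ 2⁻¹ ≤ s₀ - t ∧ s₀ - t ≤ s := by
    rcases le_total (u₀ - u) (s₀ - 2⁻¹) with h' | h'
    · exact ⟨u₀ - u, by linarith, le_rfl, by linarith, by linarith⟩
    · exact ⟨s₀ - 2⁻¹, by linarith, h', by linarith, by linarith⟩
  have anti := Real.binEntropy_strictAntiOn.antitoneOn
  have e1 : Real.binEntropy s ≤ Real.binEntropy (s₀ - t) :=
    anti ⟨ht2, by linarith⟩ ⟨hs, hs1⟩ ht3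
  have e2 : Real.binEntropy (u₀ - t) ≤ Real.binEntropy u :=
    anti ⟨hu, by linarith⟩ ⟨by linarith, by linarith⟩ (by linarith)
  suffices Real.binEntropy (s₀ - t) + Real.binEntropy u₀ ≤
      Real.binEntropy s₀ + Real.binEntropy (u₀ - t) by linarith
  rcases (show 0 ≤ u₀ - s₀ + t by linarith).eq_or_lt with h0 | h0
  · rw [show t = 0 by linarith]
    simp
  have conc := Real.strictConcave_binEntropy.concaveOn
  have m1 : s₀ - t ∈ Set.Icc (0 : ℝ) 1 := ⟨by linarith, by linarith⟩
  have m2 : u₀ ∈ Set.Icc (0 : ℝ) 1 := ⟨by linarith, by linarith⟩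
  -- Both `s₀` and `u₀ - t` lie between `s₀ - t` and `u₀`, as convex combinations with swapped
  -- weights.
  set a := t / (u₀ - s₀ + t) with ha
  have ha' : a * (u₀ - s₀ + t) = t := by rw [ha]; field_simp
  have ha0 : 0 ≤ a := by positivity
  have ha1 : a ≤ 1 := by rw [ha, div_le_one h0]; linarith
  have c1 := conc.2 m1 m2 (sub_nonneg.mpr ha1) ha0 (by ring)
  have c2 := conc.2 m1 m2 ha0 (sub_nonneg.mpr ha1) (by ring)
  simp only [smul_eq_mul] at c1 c2
  rw [show (1 - a) * (s₀ - t) + a * u₀ = s₀ by linear_combination ha'] at c1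
  rw [show a * (s₀ - t) + (1 - a) * u₀ = u₀ - t by linear_combination -ha'] at c2
  linarith

/-! ### Weighted averages, populations and reduced states -/

theorem sum_mul_le_of_support {ι : Type*} [Fintype ι] {p w : ι → ℝ} {c : ℝ}
    (hw : ∀ j, 0 ≤ w j) (h1 : ∑ j, w j = 1) (h : ∀ j, w j ≠ 0 → p j ≤ c) :
    ∑ j, p j * w j ≤ c := by
  calc ∑ j, p j * w j ≤ ∑ j, c * w j := by
        refine Finset.sum_le_sum fun j _ => ?_
        by_cases hj : w j = 0
        · simp [hj]
        · exact mul_le_mul_of_nonneg_right (h j hj) (hw j)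
    _ = c := by rw [← Finset.mul_sum, h1, mul_one]

theorem le_sum_mul_of_support {ι : Type*} [Fintype ι] {p w : ι → ℝ} {c : ℝ}
    (hw : ∀ j, 0 ≤ w j) (h1 : ∑ j, w j = 1) (h : ∀ j, w j ≠ 0 → c ≤ p j) :
    c ≤ ∑ j, p j * w j := by
  have := sum_mul_le_of_support (p := fun j => -p j) (c := -c) hw h1
    fun j hj => neg_le_neg (h j hj)
  simp only [neg_mul, Finset.sum_neg_distrib] at this
  linarith

theorem trace_traceB {d : ℕ} (ρ : Matrix (Idx d) (Idx d) ℂ) : (traceB ρ).trace = ρ.trace := by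
  simp [traceB, trace, Fintype.sum_prod_type]

theorem trace_traceA {d : ℕ} (ρ : Matrix (Idx d) (Idx d) ℂ) : (traceA ρ).trace = ρ.trace := by
  simp only [traceA, trace, Fintype.sum_prod_type, diag_apply, of_apply]
  exact Finset.sum_comm

theorem isHermitian_traceB {d : ℕ} {ρ : Matrix (Idx d) (Idx d) ℂ} (h : ρ.IsHermitian) :
    (traceB ρ).IsHermitian := by
  ext i j
  simp [traceB, h.apply]

theorem isHermitian_traceA {d : ℕ} {ρ : Matrix (Idx d) (Idx d) ℂ} (h : ρ.IsHermitian) :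
    (traceA ρ).IsHermitian := by
  ext i j
  simp [traceA, h.apply]

/-- The populations of the product basis of `G ⊗ W` in the state `R diag(p) R†`. -/
def population (p : Idx 2 → ℝ) (R : Matrix (Idx 2) (Idx 2) ℂ) (G W : Matrix (Fin 2) (Fin 2) ℂ)
    (k : Idx 2) : ℝ :=
  ∑ j, p j * Complex.normSq (((G ⊗ₖ W)ᴴ * R) k j)

section

variable {p : Idx 2 → ℝ} {R : Matrix (Idx 2) (Idx 2) ℂ} {F G W : Matrix (Fin 2) (Fin 2) ℂ}
  {s u : ℝ}

theorem conj_conj_diagonal_apply_self (k : Idx 2) :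
    ((G ⊗ₖ W)ᴴ * (R * diagonal (fun j => (p j : ℂ)) * Rᴴ) * (G ⊗ₖ W)) k k =
      (population p R G W k : ℂ) := by
  rw [population, ← conj_diagonal_apply_self, conjTranspose_mul, conjTranspose_conjTranspose]
  simp only [Matrix.mul_assoc]

theorem population_add_fst (hW : W ∈ unitaryGroup (Fin 2) ℂ) (m : Fin 2) :
    ((population p R G W (m, 0) + population p R G W (m, 1) : ℝ) : ℂ) =
      (Gᴴ * traceB (R * diagonal (fun j => (p j : ℂ)) * Rᴴ) * G) m m := by
  rw [← traceB_conj_kronecker hW, Complex.ofReal_add, ← conj_conj_diagonal_apply_self,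
    ← conj_conj_diagonal_apply_self, traceB, of_apply, Fin.sum_univ_two]

theorem population_add_snd (hG : G ∈ unitaryGroup (Fin 2) ℂ) (n : Fin 2) :
    ((population p R G W (0, n) + population p R G W (1, n) : ℝ) : ℂ) =
      (Wᴴ * traceA (R * diagonal (fun j => (p j : ℂ)) * Rᴴ) * W) n n := by
  rw [← traceA_conj_kronecker hG, Complex.ofReal_add, ← conj_conj_diagonal_apply_self,
    ← conj_conj_diagonal_apply_self, traceA, of_apply, Fin.sum_univ_two]

/-- A diagonal entry in any orthonormal basis is an average of the eigenvalues `s` and `1 - s`. -/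
theorem conj_apply_self_mem_Icc {M : Matrix (Fin 2) (Fin 2) ℂ} {x : ℝ}
    (hF : F ∈ unitaryGroup (Fin 2) ℂ) (hG : G ∈ unitaryGroup (Fin 2) ℂ) (hs : 2⁻¹ ≤ s)
    (hM : Fᴴ * M * F = diagonal ![(s : ℂ), ((1 - s : ℝ) : ℂ)]) (m : Fin 2)
    (hx : (x : ℂ) = (Gᴴ * M * G) m m) : x ∈ Set.Icc (1 - s) s := by
  have hFF : F * Fᴴ = 1 := mem_unitaryGroup_iff.mp hF
  have hMF : M = F * diagonal (fun j => ((![s, 1 - s] j : ℝ) : ℂ)) * Fᴴ := by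
    calc M = (F * Fᴴ) * M * (F * Fᴴ) := by rw [hFF, Matrix.one_mul, Matrix.mul_one]
      _ = F * (Fᴴ * M * F) * Fᴴ := by simp only [Matrix.mul_assoc]
      _ = _ := by
        rw [hM]
        congr 3
        ext i
        fin_cases i <;> rfl
  have hmul : Gᴴ * M * G =
      (Gᴴ * F) * diagonal (fun j => ((![s, 1 - s] j : ℝ) : ℂ)) * (Gᴴ * F)ᴴ := by
    rw [hMF, conjTranspose_mul, conjTranspose_conjTranspose]
    simp only [Matrix.mul_assoc]
  rw [hmul, conj_diagonal_apply_self, Complex.ofReal_inj] at hx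
  have hrow := sum_normSq_row (mul_mem (Unitary.star_mem hG) hF) m
  rw [star_eq_conjTranspose] at hrow
  rw [hx]
  refine ⟨le_sum_mul_of_support (fun _ => Complex.normSq_nonneg _) hrow fun j _ => ?_,
    sum_mul_le_of_support (fun _ => Complex.normSq_nonneg _) hrow fun j _ => ?_⟩ <;>
  fin_cases j <;> simp <;> linarith

theorem conj_kronecker_mem_unitaryGroup (hR : R ∈ unitaryGroup (Idx 2) ℂ)
    (hG : G ∈ unitaryGroup (Fin 2) ℂ) (hW : W ∈ unitaryGroup (Fin 2) ℂ) :
    (G ⊗ₖ W)ᴴ * R ∈ unitaryGroup (Idx 2) ℂ :=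
  mul_mem (Unitary.star_mem (kronecker_mem_unitary hG hW)) hR

/-- A local basis change of `A` makes one matrix entry of `R` vanish. -/
theorem exists_unitary_entry_eq_zero (n : Fin 2) (j : Idx 2) :
    ∃ G ∈ unitaryGroup (Fin 2) ℂ, ((G ⊗ₖ W)ᴴ * R) (0, n) j = 0 := by
  obtain ⟨G, hG, h⟩ := exists_unitary_conjTranspose_mulVec_zero
    fun m => ∑ b, star (W b n) * R (m, b) j
  refine ⟨G, hG, ?_⟩
  rw [← h]
  simp only [Matrix.mul_apply, Matrix.mulVec, dotProduct, Fintype.sum_prod_type,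
    conjTranspose_apply, kroneckerMap_apply, star_mul', Finset.mul_sum, mul_assoc]

end

/-! ### Constraints on the reduced spectra -/

/-- Reduced spectra `(s, 1 - s)` and `(u, 1 - u)` of a state with decreasing spectrum `p`. -/
theorem reduced_spectra_bounds {p : Idx 2 → ℝ} {R : Matrix (Idx 2) (Idx 2) ℂ}
    {F W : Matrix (Fin 2) (Fin 2) ℂ} {s u : ℝ}
    (hR : R ∈ unitaryGroup (Idx 2) ℂ)
    (h01 : p (0, 1) ≤ p (0, 0)) (h12 : p (1, 0) ≤ p (0, 1)) (h23 : p (1, 1) ≤ p (1, 0))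
    (hF : F ∈ unitaryGroup (Fin 2) ℂ) (hs : 2⁻¹ ≤ s)
    (hA : Fᴴ * traceB (R * diagonal (fun j => (p j : ℂ)) * Rᴴ) * F =
      diagonal ![(s : ℂ), ((1 - s : ℝ) : ℂ)])
    (hW : W ∈ unitaryGroup (Fin 2) ℂ)
    (hB : Wᴴ * traceA (R * diagonal (fun j => (p j : ℂ)) * Rᴴ) * W =
      diagonal ![(u : ℂ), ((1 - u : ℝ) : ℂ)]) :
    2 * p (1, 1) ≤ 1 - s ∧ u ≤ p (0, 0) + p (0, 1) ∧ p (1, 1) - p (0, 1) ≤ s - u ∧ p (1, 0) - p (0, 0) ≤ s - u := by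
  have hA' : ∀ G ∈ unitaryGroup (Fin 2) ℂ,
      population p R G W (0, 0) + population p R G W (0, 1) ∈ Set.Icc (1 - s) s :=
    fun G hG => conj_apply_self_mem_Icc hF hG hs hA 0 (population_add_fst hW 0)
  have hB0 : ∀ G ∈ unitaryGroup (Fin 2) ℂ,
      population p R G W (0, 0) + population p R G W (1, 0) = u := fun G hG => by
    have := population_add_snd (p := p) (R := R) (W := W) hG 0
    rw [hB] at this
    simpa using Complex.ofReal_injective this
  have hB1 : ∀ G ∈ unitaryGroup (Fin 2) ℂ,
      population p R G W (0, 1) + population p R G W (1, 1) = 1 - u := fun G hG => by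
    have := population_add_snd (p := p) (R := R) (W := W) hG 1
    rw [hB] at this
    simpa using Complex.ofReal_injective this
  have hle : ∀ j, p j ≤ p (0, 0) := by
    rintro ⟨a, b⟩
    fin_cases a <;> fin_cases b <;> simp <;> linarith
  have hge : ∀ j, p (1, 1) ≤ p j := by
    rintro ⟨a, b⟩
    fin_cases a <;> fin_cases b <;> simp <;> linarith
  refine ⟨?_, ?_, ?_, ?_⟩
  · have hX := conj_kronecker_mem_unitaryGroup hR hF hW
    have x (k) : p (1, 1) ≤ population p R F W k :=
      le_sum_mul_of_support (fun _ => Complex.normSq_nonneg _) (sum_normSq_row hX _)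
        fun j _ => hge j
    have := population_add_fst (p := p) (R := R) (G := F) hW 1
    rw [hA] at this
    have e : population p R F W (1, 0) + population p R F W (1, 1) = 1 - s := by
      simpa using Complex.ofReal_injective this
    linarith [x (1, 0), x (1, 1)]
  · have hX := conj_kronecker_mem_unitaryGroup hR (one_mem _) hW
    rw [← hB0 1 (one_mem _), population, population]
    set X := ((1 : Matrix (Fin 2) (Fin 2) ℂ) ⊗ₖ W)ᴴ * R
    have r0 := sum_normSq_row hX (0, 0)
    have r1 := sum_normSq_row hX (1, 0)
    have c0 := sum_normSq_col hX (0, 0)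
    have c1 := sum_normSq_col hX (0, 1)
    simp only [Fintype.sum_prod_type, Fin.sum_univ_two] at r0 r1 c0 ⊢
    have pos := fun i j => Complex.normSq_nonneg (X i j)
    -- Ky Fan's argument: `u` is a sum of `p j` with weights of total 2, the one at `(0, 0)` being
    -- at most 1; compare every `p j` with `p (0, 1)`.
    have e0 : 0 ≤ (p (0, 0) - p (0, 1)) * (Complex.normSq (X (0, 1) (0, 0)) +
        Complex.normSq (X (1, 1) (0, 0))) :=
      mul_nonneg (sub_nonneg.mpr h01) (add_nonneg (pos _ _) (pos _ _))
    have e2 : 0 ≤ (p (0, 1) - p (1, 0)) * (Complex.normSq (X (0, 0) (1, 0)) +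
        Complex.normSq (X (1, 0) (1, 0))) :=
      mul_nonneg (sub_nonneg.mpr h12) (add_nonneg (pos _ _) (pos _ _))
    have e3 : 0 ≤ (p (0, 1) - p (1, 1)) * (Complex.normSq (X (0, 0) (1, 1)) +
        Complex.normSq (X (1, 0) (1, 1))) :=
      mul_nonneg (sub_nonneg.mpr (h23.trans h12)) (add_nonneg (pos _ _) (pos _ _))
    linear_combination e0 + e2 + e3 + p (0, 1) * r0 + p (0, 1) * r1 +
      (p (0, 0) - p (0, 1)) * c0
  -- With no weight on the largest eigenvalue, population `(0, 0)` is at most `p (0, 1)`.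
  -- Subtracting the `B`-marginal `1 - u` from the `A`-marginal, which is at least `1 - s`, cancels
  -- population `(0, 1)`.
  · obtain ⟨G, hG, h0⟩ := exists_unitary_entry_eq_zero (R := R) (W := W) 0 (0, 0)
    have hX := conj_kronecker_mem_unitaryGroup hR hG hW
    have x0 : population p R G W (0, 0) ≤ p (0, 1) := by
      refine sum_mul_le_of_support (fun _ => Complex.normSq_nonneg _)
        (sum_normSq_row hX _) ?_
      rintro ⟨a, b⟩ hj
      fin_cases a <;> fin_cases b <;> simp [h0] at hj ⊢ <;> linarith
    have x1 : p (1, 1) ≤ population p R G W (1, 1) :=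
      le_sum_mul_of_support (fun _ => Complex.normSq_nonneg _) (sum_normSq_row hX _)
        fun j _ => hge j
    linarith [hB1 G hG, (hA' G hG).1]
  -- Dually, remove the smallest eigenvalue from population `(0, 1)`; population `(0, 0)` cancels.
  · obtain ⟨G, hG, h0⟩ := exists_unitary_entry_eq_zero (R := R) (W := W) 1 (1, 1)
    have hX := conj_kronecker_mem_unitaryGroup hR hG hW
    have x0 : p (1, 0) ≤ population p R G W (0, 1) := by
      refine le_sum_mul_of_support (fun _ => Complex.normSq_nonneg _)
        (sum_normSq_row hX _) ?_
      rintro ⟨a, b⟩ hj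
      fin_cases a <;> fin_cases b <;> simp [h0] at hj ⊢ <;> linarith
    have x1 : population p R G W (1, 0) ≤ p (0, 0) :=
      sum_mul_le_of_support (fun _ => Complex.normSq_nonneg _) (sum_normSq_row hX _)
        fun j _ => hle j
    linarith [hB0 G hG, (hA' G hG).2]

/-! ### Value at the optimum and global maximality -/

theorem IsEigendecomposition.conj_eq {d : ℕ} {ρ : Matrix (Idx d) (Idx d) ℂ}
    {p : Idx d → ℝ} {ψ : OrthonormalBasis (Idx d) ℂ (EuclideanSpace ℂ (Idx d))}
    (h : IsEigendecomposition ρ p ψ) (V : U d) :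
    V.1 * ρ * V.1ᴴ = (V.1 * (disentangle ψ).1ᴴ) * diagonal (fun k => (p k : ℂ)) *
      (V.1 * (disentangle ψ).1ᴴ)ᴴ := by
  rw [h.eq_conj_diagonal, conjTranspose_mul, conjTranspose_conjTranspose]
  simp only [Matrix.mul_assoc]

theorem IsEigendecomposition.conj_disentangle {d : ℕ} {ρ : Matrix (Idx d) (Idx d) ℂ}
    {p : Idx d → ℝ} {ψ : OrthonormalBasis (Idx d) ℂ (EuclideanSpace ℂ (Idx d))}
    (h : IsEigendecomposition ρ p ψ) (V : U d) :
    (V * disentangle ψ).1 * ρ * (V * disentangle ψ).1ᴴ =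
      V.1 * diagonal (fun k => (p k : ℂ)) * V.1ᴴ := by
  have hD : (disentangle ψ).1 * (disentangle ψ).1ᴴ = 1 :=
    mem_unitaryGroup_iff.mp (disentangle ψ).2
  rw [h.conj_eq, Submonoid.coe_mul, Matrix.mul_assoc V.1, hD, Matrix.mul_one]

theorem IsEigendecomposition.nonneg {d : ℕ} {ρ : Matrix (Idx d) (Idx d) ℂ}
    {p : Idx d → ℝ} {ψ : OrthonormalBasis (Idx d) ℂ (EuclideanSpace ℂ (Idx d))}
    (h : IsEigendecomposition ρ p ψ) (hρ : ρ.PosSemidef) (k : Idx d) : 0 ≤ p k := by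
  have := (hρ.mul_mul_conjTranspose_same (1 * disentangle ψ).1).diag_nonneg (i := k)
  rw [h.conj_disentangle] at this
  simpa using this

theorem IsEigendecomposition.sum_eq_trace {d : ℕ} {ρ : Matrix (Idx d) (Idx d) ℂ}
    {p : Idx d → ℝ} {ψ : OrthonormalBasis (Idx d) ℂ (EuclideanSpace ℂ (Idx d))}
    (h : IsEigendecomposition ρ p ψ) : ((∑ k, p k : ℝ) : ℂ) = ρ.trace := by
  have hD : (disentangle ψ).1 * (disentangle ψ).1ᴴ = 1 :=
    mem_unitaryGroup_iff.mp (disentangle ψ).2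
  rw [h.eq_conj_diagonal, Matrix.trace_mul_cycle, hD, one_mul, trace_diagonal]
  push_cast
  rfl

theorem trace_unitary_conj {d : ℕ} (ρ : Matrix (Idx d) (Idx d) ℂ) (V : U d) :
    (V.1 * ρ * V.1ᴴ).trace = ρ.trace := by
  rw [Matrix.trace_mul_cycle, ← star_eq_conjTranspose, mem_unitaryGroup_iff'.mp V.2, one_mul]

theorem permUnitary_conj_diagonal {d : ℕ} (s : Equiv.Perm (Idx d)) (c : Idx d → ℂ) :
    (permUnitary s).1 * diagonal c * (permUnitary s).1ᴴ = diagonal (c ∘ s.symm) := by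
  ext i j
  rw [Matrix.mul_apply]
  simp only [mul_diagonal, conjTranspose_apply, permUnitary, of_apply, diagonal_apply,
    Function.comp_apply]
  rw [Finset.sum_eq_single (s.symm i)]
  · by_cases hij : i = j <;> simp [hij, eq_comm]
  · intro k _ hk
    rw [if_neg fun h => hk (by simp [h])]
    simp
  · simp

theorem entropyDiff_optimum {ρ : Matrix (Idx 2) (Idx 2) ℂ}
    {p : Idx 2 → ℝ} {ψ : OrthonormalBasis (Idx 2) ℂ (EuclideanSpace ℂ (Idx 2))}
    (h : IsEigendecomposition ρ p ψ) (hp : ∑ k, p k = 1) :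
    entropyDiff ρ (permUnitary s5 * disentangle ψ) =
      (Real.binEntropy (p (0, 0) + p (1, 1)) - Real.binEntropy (p (0, 0) + p (0, 1))) /
        Real.log 2 := by
  simp only [Fintype.sum_prod_type, Fin.sum_univ_two] at hp
  have hA : reducedA ρ (permUnitary s5 * disentangle ψ) =
      diagonal ![((p (0, 0) + p (1, 1) : ℝ) : ℂ), ((1 - (p (0, 0) + p (1, 1)) : ℝ) : ℂ)] := by
    rw [reducedA, h.conj_disentangle, permUnitary_conj_diagonal, ← hp]
    ext i j
    fin_cases i <;> fin_cases j <;> simp [traceB, s5, diagonal_apply]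
    ring
  have hB : reducedB ρ (permUnitary s5 * disentangle ψ) =
      diagonal ![((p (0, 0) + p (0, 1) : ℝ) : ℂ), ((1 - (p (0, 0) + p (0, 1)) : ℝ) : ℂ)] := by
    rw [reducedB, h.conj_disentangle, permUnitary_conj_diagonal, ← hp]
    ext i j
    fin_cases i <;> fin_cases j <;> simp [traceA, s5, diagonal_apply]
    ring
  rw [entropyDiff, hA, hB, entropy_diagonal_qubit, entropy_diagonal_qubit, sub_div]

theorem entropyDiff_le {ρ : Matrix (Idx 2) (Idx 2) ℂ} (hρ : IsState ρ)
    {p : Idx 2 → ℝ} {ψ : OrthonormalBasis (Idx 2) ℂ (EuclideanSpace ℂ (Idx 2))}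
    (h : IsEigendecomposition ρ p ψ) (V : U 2) :
    entropyDiff ρ V ≤ entropyDiff ρ (permUnitary s5 * disentangle ψ) := by
  have hp : ∑ k, p k = 1 := by
    have := h.sum_eq_trace
    rw [hρ.2] at this
    exact_mod_cast this
  rw [entropyDiff_optimum h hp]
  simp only [Fintype.sum_prod_type, Fin.sum_univ_two] at hp
  have h01 : p (0, 1) ≤ p (0, 0) := h.decreasing _ _ (by decide)
  have h12 : p (1, 0) ≤ p (0, 1) := h.decreasing _ _ (by decide)
  have h23 : p (1, 1) ≤ p (1, 0) := h.decreasing _ _ (by decide)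
  have h3 := h.nonneg hρ.1 (1, 1)
  have hH := (hρ.1.mul_mul_conjTranspose_same V.1).isHermitian
  have htr := (trace_unitary_conj ρ V).trans hρ.2
  obtain ⟨F, hF, s, hs, hA, hSA⟩ := exists_unitary_diagonal (isHermitian_traceB hH)
    ((trace_traceB _).trans htr)
  obtain ⟨W, hW, u, hu, hB, hSB⟩ := exists_unitary_diagonal (isHermitian_traceA hH)
    ((trace_traceA _).trans htr)
  rw [entropyDiff, reducedA, reducedB, hSA, hSB, ← sub_div]
  refine div_le_div_of_nonneg_right ?_ (Real.log_nonneg one_le_two)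
  rw [h.conj_eq] at hA hB
  obtain ⟨hs1, huu, hsu, hsu'⟩ := reduced_spectra_bounds
    (mul_mem V.2 (Unitary.star_mem (disentangle ψ).2)) h01 h12 h23 hF hs hA hW hB
  -- The larger eigenvalue of the optimal `A` state decides which lower bound on `s - u` is tight.
  rcases le_total 2⁻¹ (p (0, 0) + p (1, 1)) with h0 | h0
  · exact binEntropy_sub_le hs (by linarith) hu h0 (by linarith) (by linarith) huu (by linarith)
  · rw [← Real.binEntropy_one_sub (p (0, 0) + p (1, 1))]
    exact binEntropy_sub_le hs (by linarith) hu (by linarith) (by linarith) (by linarith) huu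
      (by linarith)

end EntropyDifference

theorem theorem2 (ρ : Matrix (EntropyDifference.Idx 2) (EntropyDifference.Idx 2) ℂ)
    (hρ : EntropyDifference.IsState ρ)
    (p : EntropyDifference.Idx 2 → ℝ)
    (ψ : OrthonormalBasis (EntropyDifference.Idx 2) ℂ
      (EuclideanSpace ℂ (EntropyDifference.Idx 2)))
    (hψ : EntropyDifference.IsEigendecomposition ρ p ψ) :
    IsLocalMax (fun V : EntropyDifference.U 2 => EntropyDifference.entropyDiff ρ V)
      (EntropyDifference.permUnitary EntropyDifference.s5 *
        EntropyDifference.disentangle ψ) :=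
  Filter.Eventually.of_forall fun V => EntropyDifference.entropyDiff_le hρ hψ V
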